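/- **Definitions.** A *metrically homogeneous graph* is a connected graph $\Gamma$ such that every isometry (for the path metric $d$) between finite subspaces of $\Gamma$ extends to an isometry of $\Gamma$ onto itself. Let $\Gamma_1$ denote the set of neighbours of a vertex of $\Gamma$, with the induced metric. $\Gamma$ is of *generic type* if any two vertices at distance $2$ have infinitely many common neighbours which form an independent set (i.e. the set of common neighbours contains an infinite independent set), and if $\Gamma_1$ admits no $\mathrm{Aut}(\Gamma_1)$-invariant equivalence relation other than the equality relation and the relation with just one class. The *language* of $\Gamma$ is the set $\{i\in\mathbb N : 1\le i\le\delta\}$ of nonzero distances which occur in $\Gamma$, where $\delta\in\mathbb N\cup\{\infty\}$ is the diameter, and $\Gamma$ is viewed as the relational structure in which $R_i(u,v)$ means $d(u,v)=i$. For a permutation $\sigma$ of the language, $\Gamma^\sigma$ is the structure on the same vertices in which $R_{\sigma(i)}$ denotes the relation denoted by $R_i$ in $\Gamma$. It is *metrically homogeneous* if it is the structure in this language associated with some metrically homogeneous graph, that is, if there is a metrically homogeneous graph on the same vertex set with path metric $d'$ such that $d(u,v)=i\iff d'(u,v)=\sigma(i)$ for all vertices $u,v$ and all $i$ in the language. **Theorem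 3.5.** Let $\Gamma$ be a metrically homogeneous graph of generic type with diameter $\delta$, and let $\sigma$ be a non-trivial permutation of the language of $\Gamma$ such that $\Gamma^\sigma$ is again metrically homogeneous. Then $\delta$ is finite, and $\sigma$ is one of the permutations $\rho$, $\rho^{-1}$, $\tau_0$, $\tau_1$ of $\{1,\dots,\delta\}$, where $$\rho(i)=\begin{cases}2i & \text{if } i\le \delta/2,\\ 2(\delta-i)+1 & \text{if } i>\delta/2,\end{cases}\qquad \rho^{-1}(i)=\begin{cases} i/2 & \text{if } i \text{ is even},\\ \delta-\frac{i-1}{2} & \text{if } i\text{ is odd},\end{cases}$$ and, for $\epsilon\in\{0,1\}$, $\tau_\epsilon$ is the involution $$\tau_\epsilon(i)=\begin{cases}(\delta+\epsilon)-i & \text{if } \min(i,(\delta+\epsilon)-i)\text{ is odd},\\ i & \text{otherwise.}\end{cases}$$ -/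

import Mathlib

/-- A metrically homogeneous graph: a connected graph such that every isometry (for the path
metric) between finite subspaces extends to an isometry of the whole graph onto itself. The finite
partial isometry is given by a finite set `A` and the restriction to `A` of a map `f`. -/
def IsMetricallyHomogeneous {V : Type*} (G : SimpleGraph V) : Prop :=
  G.Connected ∧
    ∀ (A : Finset V) (f : V → V),
      (∀ x ∈ A, ∀ y ∈ A, G.dist (f x) (f y) = G.dist x y) →
        ∃ φ : Equiv.Perm V,
          (∀ x y, G.dist (φ x) (φ y) = G.dist x y) ∧ ∀ x ∈ A, φ x = f x

/-- The set of vertices at distance `i` from the basepoint `v`. -/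
def distSphere {V : Type*} (G : SimpleGraph V) (v : V) (i : ℕ) : Set V :=
  {u | G.dist v u = i}

/-- The metric space `Γ₁` of neighbours of `v` (with the metric induced from the graph) has no
equivalence relation invariant under its isometry group other than equality and the relation
in which any two points are equivalent. -/
def HasPrimitiveNeighbours {V : Type*} (G : SimpleGraph V) (v : V) : Prop :=
  ∀ r : Setoid (distSphere G v 1),
    (∀ φ : Equiv.Perm (distSphere G v 1),
      (∀ x y, G.dist (φ x : V) (φ y : V) = G.dist (x : V) (y : V)) →
        ∀ x y, r x y → r (φ x) (φ y)) →
      r = ⊥ ∨ r = ⊤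

/-- Generic type: any two vertices at distance `2` have infinitely many common neighbours which
form an independent set, and the neighbours of a vertex carry no non-trivial invariant
equivalence relation. -/
def IsGenericType {V : Type*} (G : SimpleGraph V) : Prop :=
  (∀ u v : V, G.dist u v = 2 →
    ∃ S : Set V, S.Infinite ∧ S ⊆ G.commonNeighbors u v ∧ G.IsIndepSet S) ∧
  ∀ v : V, HasPrimitiveNeighbours G v

/-- The language of a graph viewed as a metric space: the nonzero distances which occur. -/
def distanceLanguage {V : Type*} (G : SimpleGraph V) : Set ℕ :=
  {i | 0 < i ∧ ∃ u v, G.dist u v = i}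

/-- A graph as a binary relational structure: the symbol `i` denotes "at distance `i`". -/
def distanceStructure {V : Type*} (G : SimpleGraph V) :
    distanceLanguage G → V → V → Prop :=
  fun i u v => G.dist u v = i

/-- The twist of a binary relational structure with symbols in `L` by a permutation `σ` of `L`:
the symbol `σ R` denotes in the twist the relation denoted by `R` in the original. -/
def twist {L V : Type*} (M : L → V → V → Prop) (σ : Equiv.Perm L) : L → V → V → Prop :=
  fun R => M (σ.symm R)

/-- A binary relational structure whose symbols are natural numbers is a metrically homogeneous
graph, viewed in its distance language. -/
def IsMetricallyHomogeneousStructure {V : Type*} {L : Set ℕ} (M : L → V → V → Prop) : Prop :=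
  ∃ H : SimpleGraph V, IsMetricallyHomogeneous H ∧ distanceLanguage H = L ∧
    ∀ (i : L) (u v : V), M i u v ↔ H.dist u v = i

/-- `ρ`, a permutation of `{1, …, δ}`. -/
def rho (δ i : ℕ) : ℕ := if 2 * i ≤ δ then 2 * i else 2 * (δ - i) + 1

/-- `ρ⁻¹`, a permutation of `{1, …, δ}`. -/
def rhoInv (δ i : ℕ) : ℕ := if Even i then i / 2 else δ - (i - 1) / 2

/-- `τ_ε`, a permutation of `{1, …, δ}` for `ε ∈ {0, 1}`. -/
def tau (δ ε i : ℕ) : ℕ := if Odd (min i (δ + ε - i)) then δ + ε - i else i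

theorem rho_mem {δ i : ℕ} (hi : i ∈ Set.Icc 1 δ) : rho δ i ∈ Set.Icc 1 δ := by
  simp only [Set.mem_Icc, rho] at *
  split_ifs <;> omega

theorem rhoInv_rho {δ i : ℕ} (hi : i ∈ Set.Icc 1 δ) : rhoInv δ (rho δ i) = i := by
  simp only [Set.mem_Icc, rho, rhoInv, Nat.even_iff] at *
  split_ifs <;> omega

theorem rho_rhoInv {δ i : ℕ} (hi : i ∈ Set.Icc 1 δ) : rho δ (rhoInv δ i) = i := by
  simp only [Set.mem_Icc, rho, rhoInv, Nat.even_iff] at *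
  split_ifs <;> omega

theorem tau_mem {δ ε i : ℕ} (hε : ε ≤ 1) (hi : i ∈ Set.Icc 1 δ) : tau δ ε i ∈ Set.Icc 1 δ := by
  simp only [Set.mem_Icc, tau, Nat.odd_iff] at *
  split_ifs <;> omega

theorem tau_tau {δ ε i : ℕ} (hi : i ∈ Set.Icc 1 δ) : tau δ ε (tau δ ε i) = i := by
  simp only [Set.mem_Icc, tau, Nat.odd_iff] at *
  split_ifs <;> omega

/-! Let `s` be the permutation and `x` its inverse. A geodesic of either metric with parts i, j and
length i + j is a triangle of the other, so `s` and `x` satisfy the triangle inequalities at all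
such triples; this is `IsGeodesicTwist`. Everything turns on a = x 1, the old distance that becomes
adjacency. Whenever a small distance has a small image, `s` or `x` moves by a bounded amount along a
progression, and injectivity leaves it only one course. If a = 1, the permutation is trivial. If a =
2, it is ρ⁻¹ once δ ≥ 4 (`eq_rhoInv`). If 3 ≤ a < δ, then s 2 = 2 and a + 2 is not a distance, so a
= δ - 1, which leads to τ₀ (`eq_tau_zero`). If a = δ, it is ρ or τ₁ (`eq_rho`, `eq_tau_one`). With
unbounded distances only a = 1 survives.

The graph supplies what arithmetic cannot, in three places. Below the diameter each sphere has two
points at distance 2, so s 2 ≤ 2 s i. When a = δ, the last sphere has several points; since spheres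
are connected through steps of length at most 2 (`sphere_connected`), two of them are at distance 1
or 2, so s 1 ≤ 2 or s 2 ≤ 2. Finally, for δ = 5 the involution exchanging 1 with 4 and 3 with 5
passes all numerical tests, and is excluded by the geometry of a sphere of radius 2
(`false_of_triangles`). -/

/-- The constraints on a permutation `s` of `L`, with inverse `x`, imposed by geodesics when `s`
twists one metric with set of distances `L` into another. -/
structure IsGeodesicTwist (L : Set ℕ) (s x : ℕ → ℕ) : Prop where
  pos : ∀ i ∈ L, 1 ≤ i
  down : ∀ i ∈ L, ∀ j, 1 ≤ j → j ≤ i → j ∈ L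
  s_mem : ∀ i ∈ L, s i ∈ L
  x_mem : ∀ i ∈ L, x i ∈ L
  x_s : ∀ i ∈ L, x (s i) = i
  s_x : ∀ i ∈ L, s (x i) = i
  s_add : ∀ i j, 1 ≤ i → 1 ≤ j → i + j ∈ L → s (i + j) ≤ s i + s j ∧ s i ≤ s (i + j) + s j
  x_add : ∀ i j, 1 ≤ i → 1 ≤ j → i + j ∈ L → x (i + j) ≤ x i + x j ∧ x i ≤ x (i + j) + x j

/-! ### Arithmetic of geodesic twists on an arbitrary set of distances -/

namespace IsGeodesicTwist

variable {L : Set ℕ} {s x : ℕ → ℕ}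

theorem s_inj (h : IsGeodesicTwist L s x) {i j : ℕ} (hi : i ∈ L) (hj : j ∈ L) (e : s i = s j) :
    i = j := by
  rw [← h.x_s i hi, e, h.x_s j hj]

theorem x_inj (h : IsGeodesicTwist L s x) {i j : ℕ} (hi : i ∈ L) (hj : j ∈ L) (e : x i = x j) :
    i = j := by
  rw [← h.s_x i hi, e, h.s_x j hj]

/-- Since s n ≤ s (n - 1) + 1 = n, only a smaller value has to be excluded, and by induction such a
value is already its own image. -/
theorem eq_self_of_map_one (h : IsGeodesicTwist L s x) (h1 : s 1 = 1) :
    ∀ n, n ∈ L → s n = n := by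
  intro n
  induction n using Nat.strong_induction_on with
  | _ n ih =>
    intro hn
    have hp := h.pos n hn
    rcases Nat.lt_or_ge n 2 with h2 | h2
    · obtain rfl : n = 1 := by omega
      exact h1
    · have hm := h.down n hn (n - 1) (by omega) (by omega)
      have e := ih (n - 1) (by omega) hm
      have t := h.s_add (n - 1) 1 (by omega) le_rfl (by rwa [Nat.sub_add_cancel (by omega)])
      rw [Nat.sub_add_cancel (by omega)] at t
      have sp := h.pos _ (h.s_mem n hn)
      rcases Nat.lt_or_ge (s n) n with hlt | hge
      · have := ih (s n) hlt (h.s_mem n hn)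
        have := h.s_inj (h.s_mem n hn) hn this
        omega
      · omega

theorem s_two_mul (h : IsGeodesicTwist L s x) (h2 : s 2 = 1) :
    ∀ k, 1 ≤ k → 2 * k ∈ L → s (2 * k) = k := by
  intro k
  induction k using Nat.strong_induction_on with
  | _ k ih =>
    intro hk hm
    rcases Nat.lt_or_ge k 2 with hk2 | hk2
    · obtain rfl : k = 1 := by omega
      exact h2
    · have hm' := h.down _ hm (2 * (k - 1)) (by omega) (by omega)
      have e := ih (k - 1) (by omega) (by omega) hm'
      have hr : 2 * (k - 1) + 2 = 2 * k := by omega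
      have t := h.s_add (2 * (k - 1)) 2 (by omega) (by omega) (by rwa [hr])
      rw [hr] at t
      have sp := h.pos _ (h.s_mem _ hm)
      rcases Nat.lt_or_ge (s (2 * k)) k with hlt | hge
      · have hm'' := h.down _ hm (2 * s (2 * k)) (by omega) (by omega)
        have := ih _ hlt sp hm''
        have := h.s_inj hm'' hm this
        omega
      · omega

theorem s_sub (h : IsGeodesicTwist L s x) {a i : ℕ} (ha : a ∈ L) (hsa : s a = 1) (hi : 1 ≤ i)
    (hia : i < a) : s (a - i) ≤ s i + 1 := by
  have t := h.s_add (a - i) i (by omega) hi (by rwa [Nat.sub_add_cancel hia.le])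
  rw [Nat.sub_add_cancel hia.le] at t
  omega

/-- Both a - 2 and a + 2 form geodesic triples with 2 and a, so their images are at most 1 + 2. The
values 1 and 2 are taken, so both images would be 3. -/
theorem not_add_two_mem (h : IsGeodesicTwist L s x) {a : ℕ} (ha : 3 ≤ a) (hsa : s a = 1)
    (h2 : s 2 = 2) : a + 2 ∉ L := by
  intro hm
  have hd := h.down _ hm
  have h2m := hd 2 (by omega) (by omega)
  have ham := hd a (by omega) (by omega)
  have t1 := h.s_sub ham hsa (i := 2) (by omega) (by omega)
  have t2 := h.s_add 2 a (by omega) (by omega) (by rwa [Nat.add_comm])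
  have key : ∀ b ∈ L, b ≠ a → b ≠ 2 → s b ≤ 3 → s b = 3 := by
    intro b hb hba hb2 hb3
    have := h.pos _ (h.s_mem b hb)
    have n1 : s b ≠ 1 := fun e => hba (h.s_inj hb ham (e.trans hsa.symm))
    have n2 : s b ≠ 2 := fun e => hb2 (h.s_inj hb h2m (e.trans h2.symm))
    omega
  have e1 := key (a + 2) hm (by omega) (by omega) (by rw [Nat.add_comm]; omega)
  -- The collision fails only when a - 2 is 2 itself. Then 4 is the image of 1 or 3, and 3 that of
  -- 6. As s 1 and s 3 differ by at most 1, the other one is 5, against x 5 ≥ x 3 - x 2 = 4.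
  by_cases h4 : a = 4
  · subst h4
    have x2 : x 2 = 2 := by simpa [h2] using h.x_s 2 h2m
    have x3 : x 3 = 6 := by rw [← e1, h.x_s _ hm]
    have h4m := hd 4 (by omega) (by omega)
    have h5m := hd 5 (by omega) (by omega)
    have h1m := hd 1 (by omega) (by omega)
    have h3m := hd 3 (by omega) (by omega)
    have t4 := h.x_add 2 2 (by omega) (by omega) h4m
    have t5 := h.x_add 3 2 (by omega) (by omega) h5m
    have p4 := h.pos _ (h.x_mem 4 h4m)
    have q4 := h.s_x 4 h4m
    have q5 := h.s_x 5 h5m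
    have t13 := h.s_sub ham hsa (i := 1) (by omega) (by omega)
    have t31 := h.s_sub ham hsa (i := 3) (by omega) (by omega)
    have t51 := h.s_add 1 4 (by omega) (by omega) h5m
    norm_num at t13 t31 t4 t5 t51
    have n13 : s 1 ≠ s 3 := fun e => by simpa using h.s_inj h1m h3m e
    have n15 : s 1 ≠ s 5 := fun e => by simpa using h.s_inj h1m h5m e
    have n35 : s 3 ≠ s 5 := fun e => by simpa using h.s_inj h3m h5m e
    have c4 : x 4 = 1 ∨ x 4 = 2 ∨ x 4 = 3 ∨ x 4 = 4 := by omega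
    have s3 : s 3 = 4 ∨ s 1 = 4 := by
      rcases c4 with e | e | e | e <;> rw [e] at q4 <;> omega
    have c1 := h.x_s 1 h1m
    have c3 := h.x_s 3 h3m
    have c5 := h.x_s 5 h5m
    have k1 := key 1 h1m (by omega) (by omega)
    have k3 := key 3 h3m (by omega) (by omega)
    have n1 : s 1 ≠ 3 := fun e => by rw [e] at c1; omega
    have n3 : s 3 ≠ 3 := fun e => by rw [e] at c3; omega
    have m1 : s 1 ≠ 5 := fun e => by rw [e] at c1; omega
    have m3 : s 3 ≠ 5 := fun e => by rw [e] at c3; omega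
    omega
  · have e2 := key (a - 2) (hd _ (by omega) (by omega)) (by omega) (by omega) (by omega)
    have := h.s_inj hm (hd _ (by omega) (by omega)) (e1.trans e2.symm)
    omega

end IsGeodesicTwist

/-! ### The permutations ρ⁻¹ and ρ -/

namespace IsGeodesicTwist

variable {s x : ℕ → ℕ} {δ : ℕ}

/-- A twist of `{1, …, δ}` sending `2` to `1` is `ρ⁻¹`, if `δ ≥ 4`. -/
theorem eq_rhoInv (h : IsGeodesicTwist (Set.Icc 1 δ) s x) (hδ : 4 ≤ δ) (h2 : s 2 = 1) :
    ∀ i, 1 ≤ i → i ≤ δ → s i = rhoInv δ i := by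
  have ev : ∀ k, 1 ≤ k → 2 * k ≤ δ → s (2 * k) = k :=
    fun k hk hkd => h.s_two_mul h2 k hk ⟨by omega, hkd⟩
  have step : ∀ i, 1 ≤ i → i + 2 ≤ δ → s (i + 2) ≤ s i + 1 ∧ s i ≤ s (i + 2) + 1 := by
    intro i hi hid
    simpa [h2] using h.s_add i 2 hi (by omega) ⟨by omega, hid⟩
  have x1 : x 1 = 2 := by simpa [h2] using h.x_s 2 ⟨by omega, by omega⟩
  -- The even arguments use up the values 1, …, δ / 2.
  have odd_gt : ∀ i, 1 ≤ i → i ≤ δ → i % 2 = 1 → δ / 2 < s i ∧ s i ≤ δ := by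
    intro i h1 hi hodd
    obtain ⟨m1, m2⟩ := h.s_mem i ⟨h1, hi⟩
    refine ⟨?_, m2⟩
    by_contra hle
    have := h.s_inj (i := i) (j := 2 * s i) ⟨h1, hi⟩ ⟨by omega, by omega⟩
      (ev (s i) m1 (by omega)).symm
    omega
  have inj : ∀ i j, 1 ≤ i → i ≤ δ → 1 ≤ j → j ≤ δ → s i = s j → i = j :=
    fun i j h1 h2 h3 h4 => h.s_inj ⟨h1, h2⟩ ⟨h3, h4⟩
  set m := δ / 2 with hm
  have hxm : x m = 2 * m := by
    simpa [ev m (by omega) (by omega)] using h.x_s (2 * m) ⟨by omega, by omega⟩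
  have tx := h.x_add m 1 (by omega) le_rfl ⟨by omega, by omega⟩
  obtain ⟨p1, p2⟩ := h.x_mem (m + 1) ⟨by omega, by omega⟩
  have hs := h.s_x (m + 1) ⟨by omega, by omega⟩
  have hodd : x (m + 1) % 2 = 1 := by
    by_contra hev
    have := ev (x (m + 1) / 2) (by omega) (by omega)
    rw [Nat.mul_div_cancel' (by omega)] at this
    omega
  -- The least value left for odd arguments sits at the largest odd argument: were it one place
  -- earlier, both odd neighbours of that place would have the image m + 2.
  have top : x (m + 1) = 2 * (δ - m) - 1 := by
    by_contra hne
    have e : x (m + 1) = 2 * m - 1 := by omega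
    have hd : δ = 2 * m + 1 := by omega
    have t1 := step (2 * m - 3) (by omega) (by omega)
    have t2 := step (2 * m - 1) (by omega) (by omega)
    rw [show 2 * m - 3 + 2 = 2 * m - 1 by omega] at t1
    rw [show 2 * m - 1 + 2 = 2 * m + 1 by omega] at t2
    rw [e] at hs
    have o1 := odd_gt (2 * m - 3) (by omega) (by omega) (by omega)
    have o2 := odd_gt (2 * m + 1) (by omega) (by omega) (by omega)
    have i1 := inj (2 * m - 3) (2 * m - 1) (by omega) (by omega) (by omega) (by omega)
    have i2 := inj (2 * m + 1) (2 * m - 1) (by omega) (by omega) (by omega) (by omega)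
    have i3 := inj (2 * m + 1) (2 * m - 3) (by omega) (by omega) (by omega) (by omega)
    omega
  rw [top] at hs
  have od : ∀ k, ∀ i, i + 2 * k = 2 * (δ - m) - 1 → 1 ≤ i → s i = m + 1 + k := by
    intro k
    induction k using Nat.strong_induction_on with
    | _ k ih =>
      intro i hi h1
      rcases Nat.eq_zero_or_pos k with rfl | hk
      · obtain rfl : i = 2 * (δ - m) - 1 := by omega
        omega
      · have e := ih (k - 1) (by omega) (i + 2) (by omega) (by omega)
        have t := step i h1 (by omega)
        have o := odd_gt i h1 (by omega) (by omega)
        have i0 := inj i (i + 2) h1 (by omega) (by omega) (by omega)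
        rcases Nat.lt_or_ge k 2 with hk2 | hk2
        · omega
        · have e' := ih (k - 2) (by omega) (i + 4) (by omega) (by omega)
          have i0 := inj i (i + 4) h1 (by omega) (by omega) (by omega)
          omega
  intro i h1 hi
  unfold rhoInv
  split_ifs with hp
  · obtain ⟨k, rfl⟩ := hp
    have := ev k (by omega) (by omega)
    rw [two_mul] at this
    omega
  · rw [Nat.not_even_iff] at hp
    have := od ((2 * (δ - m) - 1 - i) / 2) i (by omega) h1
    omega

/-- A twist of `{1, …, δ}` sending `δ` to `1` and `1` to `2` is `ρ`. -/
theorem eq_rho (h : IsGeodesicTwist (Set.Icc 1 δ) s x) (hδ : 2 ≤ δ) (h1 : s δ = 1)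
    (h2 : s 1 = 2) : ∀ i, 1 ≤ i → i ≤ δ → s i = rho δ i := by
  have x1 : x 1 = δ := by simpa [h1] using h.x_s δ ⟨by omega, by omega⟩
  have x2 : x 2 = 1 := by simpa [h2] using h.x_s 1 ⟨by omega, by omega⟩
  have mem : ∀ k, 1 ≤ k → k ≤ δ → 1 ≤ x k ∧ x k ≤ δ := fun k h1 h2 => h.x_mem k ⟨h1, h2⟩
  have inj : ∀ i j, 1 ≤ i → i ≤ δ → 1 ≤ j → j ≤ δ → x i = x j → i = j :=
    fun i j h1 h2 h3 h4 => h.x_inj ⟨h1, h2⟩ ⟨h3, h4⟩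
  have step : ∀ k, 1 ≤ k → k + 2 ≤ δ → x (k + 2) ≤ x k + 1 ∧ x k ≤ x (k + 2) + 1 := by
    intro i hi hid
    simpa [x2] using h.x_add i 2 hi (by omega) ⟨by omega, hid⟩
  have key : ∀ k, 1 ≤ k → (2 * k ≤ δ → x (2 * k) = k) ∧ (2 * k ≤ δ + 1 →
      x (2 * k - 1) = δ + 1 - k) := by
    intro k
    induction k using Nat.strong_induction_on with
    | _ k ih =>
      intro hk
      rcases Nat.lt_or_ge k 2 with hk1 | hk1
      · obtain rfl : k = 1 := by omega
        exact ⟨fun _ => x2, fun _ => by simpa using x1⟩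
      · obtain ⟨e1, e2⟩ := ih (k - 1) (by omega) (by omega)
        constructor
        · intro hd
          have t := step (2 * (k - 1)) (by omega) (by omega)
          rw [show 2 * (k - 1) + 2 = 2 * k by omega] at t
          have m1 := mem (2 * k) (by omega) (by omega)
          have e1 := e1 (by omega)
          have i1 := inj (2 * k) (2 * (k - 1)) (by omega) (by omega) (by omega) (by omega)
          rcases Nat.lt_or_ge k 3 with hk2 | hk2
          · omega
          · have e3 := (ih (k - 2) (by omega) (by omega)).1 (by omega)
            have i1 := inj (2 * k) (2 * (k - 2)) (by omega) (by omega) (by omega) (by omega)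
            omega
        · intro hd
          have t := step (2 * (k - 1) - 1) (by omega) (by omega)
          rw [show 2 * (k - 1) - 1 + 2 = 2 * k - 1 by omega] at t
          have m1 := mem (2 * k - 1) (by omega) (by omega)
          have e2 := e2 (by omega)
          have i1 := inj (2 * k - 1) (2 * (k - 1) - 1) (by omega) (by omega) (by omega) (by omega)
          rcases Nat.lt_or_ge k 3 with hk2 | hk2
          · omega
          · have e3 := (ih (k - 2) (by omega) (by omega)).2 (by omega)
            have i1 := inj (2 * k - 1) (2 * (k - 2) - 1) (by omega) (by omega) (by omega)
              (by omega)
            omega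
  intro i hi hid
  unfold rho
  split_ifs with hp
  · have := h.s_x (2 * i) ⟨by omega, hp⟩
    rwa [(key i hi).1 hp] at this
  · have := h.s_x (2 * (δ + 1 - i) - 1) ⟨by omega, by omega⟩
    rw [(key (δ + 1 - i) (by omega)).2 (by omega), show δ + 1 - (δ + 1 - i) = i by omega] at this
    omega

end IsGeodesicTwist

/-! ### The involutions τ₀ and τ₁ -/

/-- A permutation `s` of `{1, …, N}` with inverse `x` which satisfies the constraints of a twist
with `x 1 = N`, `x 2 = 2` and `x N = 1` swaps `m` with `N + 1 - m` when the smaller of the two is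
odd, and fixes both otherwise. -/
theorem eq_or_eq_of_zigzag {s x : ℕ → ℕ} {N : ℕ}
    (mem : ∀ k, 1 ≤ k → k ≤ N → 1 ≤ x k ∧ x k ≤ N)
    (smem : ∀ k, 1 ≤ k → k ≤ N → 1 ≤ s k ∧ s k ≤ N)
    (xs : ∀ k, 1 ≤ k → k ≤ N → x (s k) = k) (sx : ∀ k, 1 ≤ k → k ≤ N → s (x k) = k)
    (x1 : x 1 = N) (x2 : 2 ≤ N → x 2 = 2) (xN : x N = 1)
    (hs : ∀ j, 1 ≤ j → j < N → s (N - j) ≤ s j + 1 ∧ s j ≤ s (N - j) + 1)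
    (hx : ∀ k, 1 ≤ k → k + 2 ≤ N → x (k + 2) ≤ x k + 2 ∧ x k ≤ x (k + 2) + 2) :
    ∀ m, 1 ≤ m → 2 * m ≤ N + 1 →
      (m % 2 = 1 → s m = N + 1 - m ∧ s (N + 1 - m) = m) ∧
      (m % 2 = 0 → s m = m ∧ s (N + 1 - m) = N + 1 - m) := by
  intro m
  induction m using Nat.strong_induction_on with
  | _ m ih =>
    intro hm hmN
    rcases Nat.lt_or_ge m 2 with h2 | h2
    · obtain rfl : m = 1 := by omega
      have a1 := sx 1 le_rfl (by omega)
      have aN := sx N (by omega) le_rfl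
      rw [x1] at a1
      rw [xN] at aN
      simp [a1, aN]
    · have hx_mid : ∀ k, m ≤ k → k ≤ N + 1 - m → m ≤ x k ∧ x k ≤ N + 1 - m := by
        intro k h1 h2
        have mk := mem k (by omega) (by omega)
        have e := sx k (by omega) (by omega)
        by_contra hcon
        have hj : x k < m ∨ N + 1 - x k < m := by omega
        rcases hj with hj | hj
        · obtain ⟨a, b⟩ := ih (x k) hj (by omega) (by omega)
          omega
        · obtain ⟨a, b⟩ := ih (N + 1 - x k) hj (by omega) (by omega)
          rw [show N + 1 - (N + 1 - x k) = x k by omega] at a b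
          omega
      have hs_mid : ∀ k, m ≤ k → k ≤ N + 1 - m → m ≤ s k ∧ s k ≤ N + 1 - m := by
        intro k h1 h2
        have mk := smem k (by omega) (by omega)
        have e := xs k (by omega) (by omega)
        by_contra hcon
        have hj : ∃ j, 1 ≤ j ∧ j < m ∧ (s k = j ∨ s k = N + 1 - j) := by
          rcases Nat.lt_or_ge (s k) m with hj | hj
          · exact ⟨s k, by omega⟩
          · exact ⟨N + 1 - s k, by omega⟩
        obtain ⟨j, hj1, hjm, hj⟩ := hj
        obtain ⟨a, b⟩ := ih j hjm hj1 (by omega)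
        have xj := xs j hj1 (by omega)
        have xj' := xs (N + 1 - j) (by omega) (by omega)
        rcases Nat.mod_two_eq_zero_or_one j with h0 | h0
        · obtain ⟨c, d⟩ := b h0
          rw [c] at xj
          rw [d] at xj'
          rcases hj with hh | hh <;> rw [hh] at e <;> omega
        · obtain ⟨c, d⟩ := a h0
          rw [c] at xj
          rw [d] at xj'
          rcases hj with hh | hh <;> rw [hh] at e <;> omega
      obtain ⟨io, ie⟩ := ih (m - 1) (by omega) (by omega) (by omega)
      have t1 := hs (m - 1) (by omega) (by omega)
      rw [show N - (m - 1) = N + 1 - m by omega] at t1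
      have u1 := hs_mid (N + 1 - m) (by omega) le_rfl
      constructor
      · intro hodd
        obtain ⟨c, d⟩ := ie (by omega)
        have e1 : s (N + 1 - m) = m := by omega
        refine ⟨?_, e1⟩
        obtain ⟨a1, a2⟩ := (ih (m - 2) (by omega) (by omega) (by omega)).1 (by omega)
        have xa := xs (m - 2) (by omega) (by omega)
        rw [a1, show N + 1 - (m - 2) = N + 1 - m + 2 by omega] at xa
        have t2 := hx (N + 1 - m) (by omega) (by omega)
        have mm := hx_mid (N + 1 - m) (by omega) le_rfl
        have e2 : x (N + 1 - m) = m := by omega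
        have := sx (N + 1 - m) (by omega) (by omega)
        rwa [e2] at this
      · intro hev
        obtain ⟨c, d⟩ := io (by omega)
        refine ⟨?_, by omega⟩
        rcases Nat.lt_or_ge m 3 with h3 | h3
        · obtain rfl : m = 2 := by omega
          have := sx 2 (by omega) (by omega)
          rwa [x2 (by omega)] at this
        · obtain ⟨a1, a2⟩ := (ih (m - 2) (by omega) (by omega) (by omega)).2 (by omega)
          have xa := xs (m - 2) (by omega) (by omega)
          rw [a1] at xa
          have t2 := hx (m - 2) (by omega) (by omega)
          rw [show m - 2 + 2 = m by omega, xa] at t2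
          have mm := hx_mid m le_rfl (by omega)
          have e2 : x m = m := by omega
          have := sx m (by omega) (by omega)
          rwa [e2] at this

namespace IsGeodesicTwist

variable {s x : ℕ → ℕ} {δ : ℕ}

theorem eq_tau_one (h : IsGeodesicTwist (Set.Icc 1 δ) s x) (hδ : 3 ≤ δ) (hsδ : s δ = 1)
    (h2 : s 2 = 2) : ∀ i, 1 ≤ i → i ≤ δ → s i = tau δ 1 i := by
  have xmem : ∀ k, 1 ≤ k → k ≤ δ → 1 ≤ x k ∧ x k ≤ δ := fun k h1 h2 => h.x_mem k ⟨h1, h2⟩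
  have smem : ∀ k, 1 ≤ k → k ≤ δ → 1 ≤ s k ∧ s k ≤ δ := fun k h1 h2 => h.s_mem k ⟨h1, h2⟩
  have xs : ∀ k, 1 ≤ k → k ≤ δ → x (s k) = k := fun k h1 h2 => h.x_s k ⟨h1, h2⟩
  have sx : ∀ k, 1 ≤ k → k ≤ δ → s (x k) = k := fun k h1 h2 => h.s_x k ⟨h1, h2⟩
  have xinj : ∀ i j, 1 ≤ i → i ≤ δ → 1 ≤ j → j ≤ δ → x i = x j → i = j :=
    fun i j h1 h2 h3 h4 => h.x_inj ⟨h1, h2⟩ ⟨h3, h4⟩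
  have x1 : x 1 = δ := by simpa [hsδ] using xs δ (by omega) le_rfl
  have x2 : x 2 = 2 := by simpa [h2] using xs 2 (by omega) (by omega)
  -- If k = s 1 < δ, then x k = 1 and x 1 = δ force x (k - 1) and x (k + 1) to be at least δ - 1.
  -- The value δ is taken, so they coincide.
  have s1 : s 1 = δ := by
    by_contra hne
    obtain ⟨k1, k2⟩ := smem 1 (by omega) (by omega)
    have xk := xs 1 (by omega) (by omega)
    set k := s 1
    have hk1 : k ≠ 1 := fun e => by rw [e] at xk; omega
    have t1 := (h.x_add 1 k le_rfl k1 ⟨by omega, by omega⟩).2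
    have t2 := (h.x_add (k - 1) 1 (by omega) le_rfl ⟨by omega, by omega⟩).1
    have t3 := (h.x_add 1 (k - 1) le_rfl (by omega) ⟨by omega, by omega⟩).2
    rw [show 1 + (k - 1) = k by omega] at t3
    rw [Nat.add_comm 1 k] at t1
    have m1 := xmem (k + 1) (by omega) (by omega)
    have m2 := xmem (k - 1) (by omega) (by omega)
    have hk2 : k ≠ 2 := fun e => by rw [e] at xk; omega
    have i1 := xinj (k + 1) 1 (by omega) (by omega) le_rfl (by omega)
    have i2 := xinj (k - 1) 1 (by omega) (by omega) le_rfl (by omega)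
    have i3 := xinj (k - 1) (k + 1) (by omega) (by omega) (by omega) (by omega)
    omega
  have xδ : x δ = 1 := by simpa [s1] using xs 1 (by omega) (by omega)
  have key := eq_or_eq_of_zigzag xmem smem xs sx x1 (fun _ => x2) xδ (by
    intro j hj hjN
    have t1 := h.s_sub (a := δ) ⟨by omega, le_rfl⟩ hsδ hj hjN
    have t2 := h.s_sub (a := δ) ⟨by omega, le_rfl⟩ hsδ (i := δ - j) (by omega) (by omega)
    rw [show δ - (δ - j) = j by omega] at t2
    exact ⟨t1, t2⟩) (by
    intro k hk hkN
    simpa [x2] using h.x_add k 2 hk (by omega) ⟨by omega, hkN⟩)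
  intro i hi hid
  simp only [tau, Nat.odd_iff]
  rcases le_total i (δ + 1 - i) with hle | hle
  · rw [min_eq_left hle]
    obtain ⟨a, b⟩ := key i hi (by omega)
    split_ifs <;> omega
  · rw [min_eq_right hle]
    obtain ⟨a, b⟩ := key (δ + 1 - i) (by omega) (by omega)
    rw [show δ + 1 - (δ + 1 - i) = i by omega] at a b
    split_ifs <;> omega

/-- With k = s 1, the images of δ and δ - 2 are k - 1 and k + 1 in some order, so `x` has large
values on both sides of k, where it is 1. If s δ < δ, steps of length 2 on the side of s δ run out
of unused values. The excluded case at δ = 5 is consistent with the inequalities and needs the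
graph. -/
theorem map_top_eq (h : IsGeodesicTwist (Set.Icc 1 δ) s x) (hδ : 4 ≤ δ) (hsδ : s (δ - 1) = 1)
    (h2 : s 2 = 2) (h5 : δ = 5 → s 1 = 4 → s 3 = 5 → s 5 = 3 → False) : s δ = δ := by
  have xmem : ∀ k, 1 ≤ k → k ≤ δ → 1 ≤ x k ∧ x k ≤ δ := fun k h1 h2 => h.x_mem k ⟨h1, h2⟩
  have smem : ∀ k, 1 ≤ k → k ≤ δ → 1 ≤ s k ∧ s k ≤ δ := fun k h1 h2 => h.s_mem k ⟨h1, h2⟩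
  have xs : ∀ k, 1 ≤ k → k ≤ δ → x (s k) = k := fun k h1 h2 => h.x_s k ⟨h1, h2⟩
  have xinj : ∀ i j, 1 ≤ i → i ≤ δ → 1 ≤ j → j ≤ δ → x i = x j → i = j :=
    fun i j h1 h2 h3 h4 => h.x_inj ⟨h1, h2⟩ ⟨h3, h4⟩
  have sinj : ∀ i j, 1 ≤ i → i ≤ δ → 1 ≤ j → j ≤ δ → s i = s j → i = j :=
    fun i j h1 h2 h3 h4 => h.s_inj ⟨h1, h2⟩ ⟨h3, h4⟩
  have hsub : ∀ j, 1 ≤ j → j < δ - 1 → s (δ - 1 - j) ≤ s j + 1 :=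
    fun j => h.s_sub ⟨by omega, by omega⟩ hsδ
  have x2 : x 2 = 2 := by simpa [h2] using xs 2 (by omega) (by omega)
  have x1 : x 1 = δ - 1 := by simpa [hsδ] using xs (δ - 1) (by omega) (by omega)
  have step : ∀ k, 1 ≤ k → k + 2 ≤ δ → x (k + 2) ≤ x k + 2 ∧ x k ≤ x (k + 2) + 2 := by
    intro k hk hkN
    simpa [x2] using h.x_add k 2 hk (by omega) ⟨by omega, hkN⟩
  have m1 := smem 1 (by omega) (by omega)
  have mδ := smem δ (by omega) (by omega)
  have mδ2 := smem (δ - 2) (by omega) (by omega)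
  have t1 := hsub 1 le_rfl (by omega)
  have t2 := hsub (δ - 2) (by omega) (by omega)
  rw [show δ - 1 - 1 = δ - 2 by omega] at t1
  rw [show δ - 1 - (δ - 2) = 1 by omega] at t2
  have t3 := h.s_add 1 (δ - 1) (by omega) (by omega) ⟨by omega, by omega⟩
  rw [show 1 + (δ - 1) = δ by omega, hsδ] at t3
  have n1 := sinj 1 (δ - 2) (by omega) (by omega) (by omega) (by omega)
  have n2 := sinj 1 δ (by omega) (by omega) (by omega) (by omega)
  have n3 := sinj (δ - 2) δ (by omega) (by omega) (by omega) (by omega)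
  have n4 := sinj δ 2 (by omega) (by omega) (by omega) (by omega)
  have n5 := sinj δ (δ - 1) (by omega) (by omega) (by omega) (by omega)
  have n6 := sinj 1 2 (by omega) (by omega) (by omega) (by omega)
  have n7 := sinj 1 (δ - 1) (by omega) (by omega) (by omega) (by omega)
  rcases Nat.lt_or_ge δ 6 with h6 | h6
  · rcases Nat.lt_or_ge δ 5 with h45 | h45
    · obtain rfl : δ = 4 := by omega
      norm_num at hsδ mδ2 t1 t2 t3 n1 n2 n3 n4 n5 n6 n7
      omega
    · obtain rfl : δ = 5 := by omega
      have n8 := sinj 3 2 (by omega) (by omega) (by omega) (by omega)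
      have n9 := sinj 3 4 (by omega) (by omega) (by omega) (by omega)
      norm_num at hsδ h5 mδ2 t1 t2 t3 n1 n2 n3 n4 n5 n6 n7
      omega
  by_contra hne
  have s3 : s (δ - 3) = 3 := by
    have t := hsub 2 (by omega) (by omega)
    rw [show δ - 1 - 2 = δ - 3 by omega] at t
    have m := smem (δ - 3) (by omega) (by omega)
    have i1 := sinj (δ - 3) (δ - 1) (by omega) (by omega) (by omega) (by omega)
    have i2 := sinj (δ - 3) 2 (by omega) (by omega) (by omega) (by omega)
    omega
  have i3 := sinj (δ - 3) δ (by omega) (by omega) (by omega) (by omega)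
  have i4 := sinj (δ - 3) (δ - 2) (by omega) (by omega) (by omega) (by omega)
  have y1 := xs 1 (by omega) (by omega)
  have yδ := xs δ (by omega) (by omega)
  have yδ2 := xs (δ - 2) (by omega) (by omega)
  have y3 := xs 3 (by omega) (by omega)
  set k := s 1
  have k3 : 3 ≤ k := by omega
  have sδ3 : 3 < s δ := by omega
  have hd : s δ = k + 1 ∧ s (δ - 2) = k - 1 ∨ s δ = k - 1 ∧ s (δ - 2) = k + 1 := by omega
  have hk3 : s (δ - 2) ≠ 3 := by omega
  clear n1 n2 n3 n4 n5 n6 n7 i3 i4 t1 t2 t3 h5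
  -- The point p lies two steps from k, just past s δ. It exists in the upward case because s δ < δ,
  -- and x p ≤ x k + 2 = 3 with 1 and 2 taken.
  have hp : ∃ p, 1 ≤ p ∧ p ≤ δ ∧ x p = 3 ∧ (s δ = k + 1 ∧ p = k + 2 ∨ s δ = k - 1 ∧ p + 2 = k) := by
    have hex : ∃ p, 1 ≤ p ∧ p ≤ δ ∧ x p ≤ 3 ∧
        (s δ = k + 1 ∧ p = k + 2 ∨ s δ = k - 1 ∧ p + 2 = k) := by
      rcases Nat.lt_or_ge (s δ) k with hlt | hge
      · refine ⟨k - 2, by omega, by omega, ?_, by omega⟩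
        have := step (k - 2) (by omega) (by omega)
        rw [show k - 2 + 2 = k by omega] at this
        omega
      · refine ⟨k + 2, by omega, by omega, ?_, by omega⟩
        have := step k (by omega) (by omega)
        omega
    obtain ⟨p, p1, p2, p3, p4⟩ := hex
    refine ⟨p, p1, p2, ?_, p4⟩
    have m := xmem p p1 p2
    have j1 := xinj p k p1 p2 (by omega) (by omega)
    have j2 := xinj p 2 p1 p2 (by omega) (by omega)
    omega
  obtain ⟨p, p1, p2, p3, p4⟩ := hp
  -- The point just past p would be sent by `x` to at least δ - 2, but δ - 2, δ - 1 and δ are all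
  -- taken. If p is already an endpoint of the range, a direct clash arises instead.
  rcases p4 with ⟨p4, p5⟩ | ⟨p4, p5⟩
  · rcases Nat.lt_or_ge p δ with hlt | hge
    · have t := step (k + 1) (by omega) (by omega)
      rw [← p4, yδ, p4] at t
      have m := xmem (k + 1 + 2) (by omega) (by omega)
      have j1 := xinj (k + 1 + 2) (s δ) (by omega) (by omega) (by omega) (by omega)
      have j2 := xinj (k + 1 + 2) 1 (by omega) (by omega) (by omega) (by omega)
      have j3 := xinj (k + 1 + 2) (s (δ - 2)) (by omega) (by omega) (by omega) (by omega)
      omega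
    · have t := step (k - 2) (by omega) (by omega)
      rw [show k - 2 + 2 = k by omega, y1] at t
      have m := xmem (k - 2) (by omega) (by omega)
      have j1 := xinj (k - 2) p (by omega) (by omega) (by omega) (by omega)
      have j2 := xinj (k - 2) 2 (by omega) (by omega) (by omega) (by omega)
      have j3 := xinj (k - 2) k (by omega) (by omega) (by omega) (by omega)
      have d6 : k - 2 = 2 := by omega
      omega
  · rcases Nat.lt_or_ge p 2 with hlt | hge
    · obtain rfl : p = 1 := by omega
      omega
    · have t := step (p - 1) (by omega) (by omega)
      rw [show p - 1 + 2 = s δ by omega, yδ] at t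
      have m := xmem (p - 1) (by omega) (by omega)
      have j1 := xinj (p - 1) (s δ) (by omega) (by omega) (by omega) (by omega)
      have j2 := xinj (p - 1) 1 (by omega) (by omega) (by omega) (by omega)
      have j3 := xinj (p - 1) (s (δ - 2)) (by omega) (by omega) (by omega) (by omega)
      omega

/-- As δ is fixed, `s` restricts to {1, …, δ - 1}, where it satisfies the hypotheses of
`eq_or_eq_of_zigzag` with N = δ - 1. -/
theorem eq_tau_zero (h : IsGeodesicTwist (Set.Icc 1 δ) s x) (hδ : 4 ≤ δ) (hsδ : s (δ - 1) = 1)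
    (h2 : s 2 = 2) (htop : s δ = δ) : ∀ i, 1 ≤ i → i ≤ δ → s i = tau δ 0 i := by
  obtain ⟨N, rfl⟩ : ∃ N, δ = N + 1 := ⟨δ - 1, by omega⟩
  rw [Nat.add_sub_cancel] at hsδ
  have xtop : x (N + 1) = N + 1 := by simpa [htop] using h.x_s (N + 1) ⟨by omega, by omega⟩
  have xmem : ∀ k, 1 ≤ k → k ≤ N → 1 ≤ x k ∧ x k ≤ N := by
    intro k h1 h2
    have a := h.x_mem k ⟨h1, by omega⟩
    have b := h.x_inj (i := k) (j := N + 1) ⟨h1, by omega⟩ ⟨by omega, by omega⟩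
    obtain ⟨a1, a2⟩ := a
    omega
  have smem : ∀ k, 1 ≤ k → k ≤ N → 1 ≤ s k ∧ s k ≤ N := by
    intro k h1 h2
    have a := h.s_mem k ⟨h1, by omega⟩
    have b := h.s_inj (i := k) (j := N + 1) ⟨h1, by omega⟩ ⟨by omega, by omega⟩
    obtain ⟨a1, a2⟩ := a
    omega
  have xs : ∀ k, 1 ≤ k → k ≤ N → x (s k) = k := fun k h1 h2 => h.x_s k ⟨h1, by omega⟩
  have sx : ∀ k, 1 ≤ k → k ≤ N → s (x k) = k := fun k h1 h2 => h.s_x k ⟨h1, by omega⟩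
  have x1 : x 1 = N := by simpa [hsδ] using xs N (by omega) le_rfl
  have x2 : x 2 = 2 := by simpa [h2] using xs 2 (by omega) (by omega)
  have s1 : s 1 = N := by
    have t := h.s_add 1 N le_rfl (by omega) ⟨by omega, by omega⟩
    rw [Nat.add_comm 1 N, htop] at t
    have := smem 1 le_rfl (by omega)
    omega
  have xN : x N = 1 := by simpa [s1] using xs 1 (by omega) (by omega)
  have key := eq_or_eq_of_zigzag xmem smem xs sx x1 (fun _ => x2) xN (by
    intro j hj hjN
    have t1 := h.s_sub (a := N) ⟨by omega, by omega⟩ hsδ hj hjN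
    have t2 := h.s_sub (a := N) ⟨by omega, by omega⟩ hsδ (i := N - j) (by omega) (by omega)
    rw [show N - (N - j) = j by omega] at t2
    exact ⟨t1, t2⟩) (by
    intro k hk hkN
    simpa [x2] using h.x_add k 2 hk (by omega) ⟨by omega, by omega⟩)
  intro i hi hid
  simp only [tau, Nat.odd_iff, Nat.add_zero]
  rcases Nat.lt_or_ge N i with hN | hN
  · obtain rfl : i = N + 1 := by omega
    simp [htop]
  rcases le_total i (N + 1 - i) with hle | hle
  · rw [min_eq_left hle]
    obtain ⟨a, b⟩ := key i hi (by omega)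
    split_ifs <;> omega
  · rw [min_eq_right hle]
    obtain ⟨a, b⟩ := key (N + 1 - i) (by omega) (by omega)
    rw [show N + 1 - (N + 1 - i) = i by omega] at a b
    split_ifs <;> omega

/-! ### Case analysis on the distance that becomes 1 -/

theorem map_two_eq {L : Set ℕ} (h : IsGeodesicTwist L s x)
    (hiso : ∀ i, 1 ≤ i → i + 1 ∈ L → s 2 ≤ s i + s i) {a : ℕ} (ha : 3 ≤ a) (hsa : s a = 1)
    (hm : a + 1 ∈ L) : s 2 = 2 := by
  have h2m := h.down _ hm 2 (by omega) (by omega)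
  have ham := h.down _ hm a (by omega) (by omega)
  have t := hiso a (by omega) hm
  have p := h.pos _ (h.s_mem 2 h2m)
  have n : s 2 ≠ 1 := fun e => by
    have := h.s_inj h2m ham (e.trans hsa.symm)
    omega
  omega

/-- If a = 2, the even numbers already exhaust all values and none is left for 1; if a ≥ 3, then a +
2 could not be a distance. -/
theorem map_one_eq_of_unbounded {L : Set ℕ} (h : IsGeodesicTwist L s x)
    (hL : ∀ i, 1 ≤ i → i ∈ L) (hiso : ∀ i, 1 ≤ i → i + 1 ∈ L → s 2 ≤ s i + s i) : s 1 = 1 := by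
  have hsa := h.s_x 1 (hL 1 le_rfl)
  have pa := h.pos _ (h.x_mem 1 (hL 1 le_rfl))
  set a := x 1
  rcases Nat.lt_or_ge a 3 with h3 | h3
  · rcases Nat.lt_or_ge a 2 with h2 | h2
    · obtain h1 : a = 1 := by omega
      rwa [h1] at hsa
    · obtain h2 : a = 2 := by omega
      rw [h2] at hsa
      have p := h.pos _ (h.s_mem 1 (hL 1 le_rfl))
      have := h.s_two_mul hsa (s 1) p (hL _ (by omega))
      have := h.s_inj (hL _ (by omega)) (hL 1 le_rfl) this
      omega
  · exact absurd (hL _ (by omega))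
      (h.not_add_two_mem h3 hsa (h.map_two_eq hiso h3 hsa (hL _ (by omega))))

theorem classification (h : IsGeodesicTwist (Set.Icc 1 δ) s x)
    (hne : ∃ i, 1 ≤ i ∧ i ≤ δ ∧ s i ≠ i)
    (hiso : ∀ i, 1 ≤ i → i + 1 ≤ δ → s 2 ≤ s i + s i)
    (htop : 3 ≤ δ → s δ = 1 → s 1 ≤ 2 ∨ s 2 ≤ 2)
    (h5 : δ = 5 → s 4 = 1 → s 2 = 2 → s 1 = 4 → s 3 = 5 → s 5 = 3 → False) :
    (∀ i, 1 ≤ i → i ≤ δ → s i = rho δ i) ∨ (∀ i, 1 ≤ i → i ≤ δ → s i = rhoInv δ i) ∨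
      (∀ i, 1 ≤ i → i ≤ δ → s i = tau δ 0 i) ∨ (∀ i, 1 ≤ i → i ≤ δ → s i = tau δ 1 i) := by
  have smem : ∀ k, 1 ≤ k → k ≤ δ → 1 ≤ s k ∧ s k ≤ δ := fun k h1 h2 => h.s_mem k ⟨h1, h2⟩
  have sinj : ∀ i j, 1 ≤ i → i ≤ δ → 1 ≤ j → j ≤ δ → s i = s j → i = j :=
    fun i j h1 h2 h3 h4 => h.s_inj ⟨h1, h2⟩ ⟨h3, h4⟩
  obtain ⟨i, hi1, hid, hi⟩ := hne
  have hsa := h.s_x 1 ⟨le_rfl, by omega⟩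
  obtain ⟨pa, paδ⟩ := h.x_mem 1 ⟨le_rfl, by omega⟩
  set a := x 1
  rcases Nat.lt_or_ge a 3 with h3 | h3
  · rcases Nat.lt_or_ge a 2 with h2 | h2
    · have h1 : a = 1 := by omega
      rw [h1] at hsa
      exact absurd (h.eq_self_of_map_one hsa i ⟨hi1, hid⟩) hi
    · have h2 : a = 2 := by omega
      rw [h2] at hsa
      rcases Nat.lt_or_ge δ 4 with h4 | h4
      · have m1 := smem 1 le_rfl (by omega)
        have i1 := sinj 1 2 le_rfl (by omega) (by omega) (by omega)
        rcases Nat.lt_or_ge δ 3 with h5 | h5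
        · obtain rfl : δ = 2 := by omega
          exact Or.inl (h.eq_rho le_rfl hsa (by omega))
        · obtain rfl : δ = 3 := by omega
          have m3 := smem 3 (by omega) le_rfl
          have i2 := sinj 3 2 (by omega) (by omega) (by omega) (by omega)
          have i3 := sinj 3 1 (by omega) (by omega) (by omega) (by omega)
          rcases Nat.lt_or_ge (s 1) 3 with h6 | h6
          · refine Or.inr (Or.inr (Or.inl fun i hi1 hi3 => ?_))
            have e1 : s 1 = 2 := by omega
            have e3 : s 3 = 3 := by omega
            interval_cases i <;> simp [tau, *]
          · refine Or.inr (Or.inl fun i hi1 hi3 => ?_)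
            have e1 : s 1 = 3 := by omega
            have e3 : s 3 = 2 := by omega
            interval_cases i <;> (simp [rhoInv, *]; try decide)
      · exact Or.inr (Or.inl (h.eq_rhoInv h4 hsa))
  · rcases Nat.lt_or_ge a δ with hlt | hge
    · have e2 := h.map_two_eq (fun i hi hi' => hiso i hi hi'.2) h3 hsa ⟨by omega, hlt⟩
      have hnot := h.not_add_two_mem h3 hsa e2
      rw [Set.mem_Icc] at hnot
      have hd : a = δ - 1 := by omega
      rw [hd] at hsa
      refine Or.inr (Or.inr (Or.inl (h.eq_tau_zero (by omega) hsa e2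
        (h.map_top_eq (by omega) hsa e2 fun hδ => ?_))))
      subst hδ
      exact h5 rfl hsa e2
    · have hd : a = δ := by omega
      rw [hd] at hsa h3
      have p1 := smem 1 le_rfl (by omega)
      have p2 := smem 2 (by omega) (by omega)
      have n1 := sinj 1 δ le_rfl (by omega) (by omega) le_rfl
      have n2 := sinj 2 δ (by omega) (by omega) (by omega) le_rfl
      rcases htop h3 hsa with h1 | h1
      · exact Or.inl (h.eq_rho (by omega) hsa (by omega))
      · exact Or.inr (Or.inr (Or.inr (h.eq_tau_one h3 hsa (by omega))))

end IsGeodesicTwist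

/-! ### Geodesics, homogeneity and generic type -/

theorem SimpleGraph.Connected.exists_between {V : Type*} {G : SimpleGraph V} (hc : G.Connected)
    (u v : V) {k : ℕ} (hk : k ≤ G.dist u v) :
    ∃ w, G.dist u w = k ∧ G.dist w v = G.dist u v - k := by
  obtain ⟨p, hp⟩ := hc.exists_walk_length_eq_dist u v
  have h1 := G.dist_le (p.take k)
  have h2 := G.dist_le (p.drop k)
  rw [SimpleGraph.Walk.take_length] at h1
  rw [SimpleGraph.Walk.drop_length] at h2
  have t := hc.dist_triangle (u := u) (v := p.getVert k) (w := v)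
  exact ⟨p.getVert k, by omega, by omega⟩

theorem SimpleGraph.Connected.dist_eq_two {V : Type*} {G : SimpleGraph V} (hc : G.Connected)
    {u v w : V} (hu : G.dist w u = 1) (hv : G.dist w v = 1) (hne : u ≠ v)
    (h1 : G.dist u v ≠ 1) : G.dist u v = 2 := by
  have t := hc.dist_triangle (u := u) (v := w) (w := v)
  have p := hc.pos_dist_of_ne hne
  rw [G.dist_comm (u := u) (v := w)] at t
  omega

namespace IsMetricallyHomogeneous

variable {V : Type*} {G : SimpleGraph V}

theorem exists_isometry (hG : IsMetricallyHomogeneous G) {u v w u' v' w' : V}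
    (huv : G.dist u' v' = G.dist u v) (huw : G.dist u' w' = G.dist u w)
    (hvw : G.dist v' w' = G.dist v w) :
    ∃ φ : Equiv.Perm V, (∀ x y, G.dist (φ x) (φ y) = G.dist x y) ∧
      φ u = u' ∧ φ v = v' ∧ φ w = w' := by
  classical
  have heq : ∀ {a b a' b' : V}, G.dist a' b' = G.dist a b → a = b → a' = b' := by
    rintro a b a' b' h rfl
    rwa [SimpleGraph.dist_self, hG.1.dist_eq_zero_iff] at h
  set f : V → V := fun z => if z = u then u' else if z = v then v' else w' with hf
  have fu : f u = u' := by simp [hf]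
  have fv : f v = v' := by
    by_cases h : v = u
    · simp [hf, h, heq huv h.symm]
    · simp [hf, h]
  have fw : f w = w' := by
    by_cases h : w = u
    · rw [h, fu, heq huw h.symm]
    · by_cases h' : w = v
      · rw [h', fv, heq hvw h'.symm]
      · simp [hf, h, h']
  obtain ⟨φ, h1, h2⟩ := hG.2 {u, v, w} f (by
    intro a ha b hb
    simp only [Finset.mem_insert, Finset.mem_singleton] at ha hb
    rcases ha with rfl | rfl | rfl <;> rcases hb with rfl | rfl | rfl <;>
      simp only [fu, fv, fw, SimpleGraph.dist_self, huv, huw, hvw] <;>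
      rw [G.dist_comm, G.dist_comm (u := a)] <;> assumption)
  exact ⟨φ, h1, (h2 u (by simp)).trans fu, (h2 v (by simp)).trans fv, (h2 w (by simp)).trans fw⟩

theorem exists_extend₃ (hG : IsMetricallyHomogeneous G) {u v w u' v' w' : V}
    (huv : G.dist u' v' = G.dist u v) (huw : G.dist u' w' = G.dist u w)
    (hvw : G.dist v' w' = G.dist v w) (z : V) :
    ∃ z', G.dist u' z' = G.dist u z ∧ G.dist v' z' = G.dist v z ∧ G.dist w' z' = G.dist w z := by
  obtain ⟨φ, h, rfl, rfl, rfl⟩ := hG.exists_isometry huv huw hvw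
  exact ⟨φ z, h _ _, h _ _, h _ _⟩

theorem exists_extend₂ (hG : IsMetricallyHomogeneous G) {u v u' v' : V}
    (huv : G.dist u' v' = G.dist u v) (z : V) :
    ∃ z', G.dist u' z' = G.dist u z ∧ G.dist v' z' = G.dist v z := by
  obtain ⟨z', h1, h2, -⟩ := hG.exists_extend₃ huv huv (by simp) z
  exact ⟨z', h1, h2⟩

end IsMetricallyHomogeneous

namespace IsGenericType

variable {V : Type*} {G : SimpleGraph V}

theorem exists_common_neighbors (hgen : IsGenericType G) (hc : G.Connected) {u v : V}
    (h : G.dist u v = 2) :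
    ∃ p q, G.dist p q = 2 ∧ G.dist u p = 1 ∧ G.dist v p = 1 ∧ G.dist u q = 1 ∧ G.dist v q = 1 := by
  obtain ⟨S, hinf, hS, hind⟩ := hgen.1 u v h
  obtain ⟨p, hp, q, hq, hne⟩ := hinf.nontrivial
  obtain ⟨p1, p2⟩ := (SimpleGraph.mem_commonNeighbors G).1 (hS hp)
  obtain ⟨q1, q2⟩ := (SimpleGraph.mem_commonNeighbors G).1 (hS hq)
  have n := hind hp hq hne
  rw [← SimpleGraph.dist_eq_one_iff_adj] at p1 p2 q1 q2 n
  exact ⟨p, q, hc.dist_eq_two p1 q1 hne n, p1, p2, q1, q2⟩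

/-- A vertex `z` at distance `i + 2` from `u` has two neighbours at distance `2` from each other
and `i + 1` from `u`. -/
theorem exists_neighbors_below (hgen : IsGenericType G) (hc : G.Connected) {u z : V} {i : ℕ}
    (h : G.dist u z = i + 2) :
    ∃ p q, G.dist p q = 2 ∧ G.dist u p = i + 1 ∧ G.dist u q = i + 1 ∧ G.dist p z = 1 ∧
      G.dist q z = 1 := by
  obtain ⟨w, h1, h2⟩ := hc.exists_between u z (k := i) (by omega)
  obtain ⟨p, q, e, wp, zp, wq, zq⟩ := hgen.exists_common_neighbors hc (u := w) (v := z) (by omega)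
  have a1 := hc.dist_triangle (u := u) (v := w) (w := p)
  have a2 := hc.dist_triangle (u := u) (v := w) (w := q)
  rw [SimpleGraph.dist_comm] at zp zq
  have b1 := hc.dist_triangle (u := u) (v := p) (w := z)
  have b2 := hc.dist_triangle (u := u) (v := q) (w := z)
  exact ⟨p, q, e, by omega, by omega, zp, zq⟩

/-- If there are triangles, then the graph induced on the neighbours of a vertex is connected. -/
theorem neighbors_induction (hgen : IsGenericType G) (hG : IsMetricallyHomogeneous G)
    (htri : ∃ c e f, G.dist c e = 1 ∧ G.dist c f = 1 ∧ G.dist e f = 1) (c : V) (P : V → Prop)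
    (hP : ∀ a b, G.dist c a = 1 → G.dist c b = 1 → G.dist a b = 1 → P a → P b) {p q : V}
    (hp : G.dist c p = 1) (hq : G.dist c q = 1) (h : P p) : P q := by
  obtain ⟨c', e', f', h1, h2, h3⟩ := htri
  obtain ⟨φ, hφ, rfl, -⟩ := hG.exists_isometry (u := c') (v := c') (w := c') (u' := c) (v' := c)
    (w' := c) (by simp) (by simp) (by simp)
  -- The relation generated by adjacency is invariant, and the triangle makes it differ from
  -- equality, so by primitivity it has one class.
  set r : Setoid (distSphere G (φ c') 1) :=
    Relation.EqvGen.setoid (fun a b => G.dist (a : V) (b : V) = 1) with hr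
  rcases hgen.2 (φ c') r (by
    intro ψ hψ x y hxy
    induction hxy with
    | rel a b hab => exact .rel _ _ (by rw [hψ]; exact hab)
    | refl a => exact .refl _
    | symm a b _ ih => exact .symm _ _ ih
    | trans a b d _ _ i1 i2 => exact .trans _ _ _ i1 i2) with hbot | htop
  · have hrel : r ⟨φ e', (hφ _ _).trans h1⟩ ⟨φ f', (hφ _ _).trans h2⟩ :=
      .rel _ _ (by simp [hφ, h3])
    rw [hbot] at hrel
    have he : φ e' = φ f' := congrArg Subtype.val hrel
    rw [φ.injective he, SimpleGraph.dist_self] at h3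
    omega
  · have hrel : r ⟨p, hp⟩ ⟨q, hq⟩ := by rw [htop]; trivial
    have key : ∀ a b : distSphere G (φ c') 1, r a b → (P a ↔ P b) := by
      intro a b hab
      induction hab with
      | rel a b hab =>
        exact ⟨hP _ _ a.2 b.2 hab, hP _ _ b.2 a.2 (by rw [SimpleGraph.dist_comm]; exact hab)⟩
      | refl a => rfl
      | symm a b _ ih => exact ih.symm
      | trans a b d _ _ i1 i2 => exact i1.trans i2
    exact (key _ _ hrel).1 h

/-- Two vertices at distance `j + 1` from `u` with a common neighbour at distance `j` from `u` have
a common neighbour at distance `j + 2` from `u`, unless `j + 2` exceeds the diameter. -/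
theorem exists_common_neighbor_above (hgen : IsGenericType G) (hG : IsMetricallyHomogeneous G)
    {j : ℕ} (hj : ∃ a b, G.dist a b = j + 2) {u c c' w : V} (hc : G.dist u c = j + 1)
    (hc' : G.dist u c' = j + 1) (hw : G.dist u w = j) (hwc : G.dist w c = 1)
    (hwc' : G.dist w c' = 1) (hne : c ≠ c') :
    ∃ z, G.dist u z = j + 2 ∧ G.dist c z = 1 ∧ G.dist c' z = 1 := by
  obtain ⟨a, b, hab⟩ := hj
  by_cases h1 : G.dist c c' = 1
  · obtain ⟨b', hb1, hb2⟩ := hG.1.exists_between a b (k := j + 1) (by omega)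
    obtain ⟨z, hz1, hz2⟩ := hG.exists_extend₂ (u := a) (v := b') (u' := u) (v' := c')
      (by omega) b
    have hcw : G.dist c' w = 1 := by rwa [SimpleGraph.dist_comm]
    by_contra hcon
    push Not at hcon
    -- A path among the neighbours of c' from w up to `z` must cross an edge from level j + 1 to
    -- level j + 2. Homogeneity moves its lower end to c, and its upper end becomes the forbidden
    -- common neighbour.
    have key := hgen.neighbors_induction hG ⟨w, c, c', hwc, hwc', h1⟩ c'
      (fun p => G.dist u p ≤ j + 1) (by
        intro p q hp hq hpq hp1
        have t := hG.1.dist_triangle (u := u) (v := p) (w := q)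
        by_contra hq1
        have hp2 : G.dist u p = j + 1 := by omega
        obtain ⟨y, hy1, hy2, hy3⟩ := hG.exists_extend₃ (u := u) (v := c') (w := p) (u' := u)
          (v' := c') (w' := c) rfl (by omega) (by rw [G.dist_comm]; omega) q
        exact hcon y (by omega) (by omega) (by omega)) hcw (by omega : G.dist c' z = 1)
      (by omega)
    omega
  · have h2 := hG.1.dist_eq_two hwc hwc' hne h1
    obtain ⟨p, q, hpq, hp, hq, hpb, hqb⟩ := hgen.exists_neighbors_below hG.1 hab
    obtain ⟨z, hz1, hz2, hz3⟩ := hG.exists_extend₃ (u := a) (v := p) (w := q) (u' := u) (v' := c)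
      (w' := c') (by omega) (by omega) (by omega) b
    exact ⟨z, by omega, by omega, by omega⟩

end IsGenericType

/-! ### Connectedness of spheres -/

/-- Two vertices at distance `j + 1` from `u` with a common neighbour at distance `j` from `u`. -/
def SphereStep {V : Type*} (G : SimpleGraph V) (u : V) (j : ℕ) (x y : V) : Prop :=
  G.dist u x = j + 1 ∧ G.dist u y = j + 1 ∧ ∃ w, G.dist u w = j ∧ G.dist w x = 1 ∧ G.dist w y = 1

namespace IsGenericType

variable {V : Type*} {G : SimpleGraph V}

-- A chain in one sphere lifts to the next: consecutive distinct vertices have a common neighbour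
-- above them, and two upper vertices over the same lower vertex are one step apart.
open Relation in
theorem sphere_connected (hgen : IsGenericType G) (hG : IsMetricallyHomogeneous G) (u : V) :
    ∀ j, ∀ x y, G.dist u x = j + 1 → G.dist u y = j + 1 →
      ReflTransGen (SphereStep G u j) x y := by
  intro j
  induction j with
  | zero => exact fun x y hx hy => .single ⟨hx, hy, u, by simp, hx, hy⟩
  | succ j ih =>
    intro x y hx hy
    obtain ⟨x', hx1, hx2⟩ := hG.1.exists_between u x (k := j + 1) (by omega)
    obtain ⟨y', hy1, hy2⟩ := hG.1.exists_between u y (k := j + 1) (by omega)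
    have key : ∀ c, ReflTransGen (SphereStep G u j) c y' → G.dist u c = j + 1 →
        ∀ x, G.dist u x = j + 2 → G.dist c x = 1 →
          ReflTransGen (SphereStep G u (j + 1)) x y := by
      intro c hc
      induction hc using ReflTransGen.head_induction_on with
      | refl => exact fun _ x hx hcx => .single ⟨hx, hy, y', hy1, hcx, by omega⟩
      | @head c d hcd _ ih' =>
        intro hcu x hx hcx
        obtain ⟨-, hd, w, hw, hwc, hwd⟩ := hcd
        by_cases hne : c = d
        · subst hne
          exact ih' hcu x hx hcx
        · obtain ⟨z, hz, hcz, hdz⟩ := hgen.exists_common_neighbor_above hG ⟨u, x, hx⟩ hcu hd hw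
            hwc hwd hne
          exact .head ⟨hx, hz, c, hcu, hcx, hcz⟩ (ih' hd z hz hdz)
    exact key x' (ih x' y' hx1 hy1) hx1 x hx (by omega)

/-- If a sphere has more than one point, then it has two points at distance `1` or `2`. -/
theorem exists_close_of_ne (hgen : IsGenericType G) (hG : IsMetricallyHomogeneous G) {u y y' : V}
    {j : ℕ} (hy : G.dist u y = j + 1) (hy' : G.dist u y' = j + 1) (hne : y ≠ y') :
    ∃ z z', G.dist u z = j + 1 ∧ G.dist u z' = j + 1 ∧ (G.dist z z' = 1 ∨ G.dist z z' = 2) := by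
  by_contra hcon
  push Not at hcon
  refine hne ?_
  induction hgen.sphere_connected hG u j y y' hy hy' with
  | refl => rfl
  | tail _ hstep ih =>
    obtain ⟨hb, hc, w, -, h1, h2⟩ := hstep
    rename_i b c _
    by_contra hyc
    have e : b = c := by
      by_contra hbc
      have h := hcon b c hb hc
      exact h.2 (hG.1.dist_eq_two h1 h2 hbc h.1)
    subst e
    exact hyc (ih hb hyc)

/-- The sphere of radius 2 about u turns out to be connected by edges, while no edge in it leads
from distance 2 to another distance from v. So all its points are at distance 2 from v, against the
triangle (4, 2, 4). -/
theorem false_of_triangles (hgen : IsGenericType G) (hG : IsMetricallyHomogeneous G)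
    (h5 : ∃ a b, G.dist a b = 5)
    (h414 : ∀ u v w, G.dist u v = 4 → G.dist v w = 1 → G.dist u w ≠ 4)
    (h423 : ∀ u v w, G.dist u v = 4 → G.dist u w = 2 → G.dist v w ≠ 3)
    (h221 : ∃ u v w, G.dist u v = 2 ∧ G.dist u w = 2 ∧ G.dist v w = 1)
    (h424 : ∃ u v w, G.dist u v = 4 ∧ G.dist u w = 2 ∧ G.dist v w = 4) : False := by
  have hc := hG.1
  -- Triangles would connect the neighbours of a vertex at distance 4 from a. None of them is at
  -- distance 4, so no edge leads from those at distance 3 to those at distance 5.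
  have htri : ∀ c e f, G.dist c e = 1 → G.dist c f = 1 → G.dist e f ≠ 1 := by
    intro c e f h1 h2 h3
    obtain ⟨a, b, hab⟩ := h5
    obtain ⟨b', hb1, hb2⟩ := hc.exists_between a b (k := 4) (by omega)
    obtain ⟨b'', hb3, hb4⟩ := hc.exists_between a b' (k := 3) (by omega)
    have key := hgen.neighbors_induction hG ⟨c, e, f, h1, h2, h3⟩ b' (fun p => G.dist a p ≤ 3) (by
      intro p q hp hq hpq hp3
      have t := hc.dist_triangle (u := a) (v := p) (w := q)
      have := h414 a b' q hb1 hq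
      omega) (p := b'') (q := b) (by rw [G.dist_comm]; omega) (by omega) (by omega)
    omega
  -- One configuration suffices by homogeneity: `q` is the middle vertex for u, p and a second
  -- common neighbour `z` of p' and `q`.
  have hmid : ∀ u x y, G.dist u x = 2 → G.dist u y = 2 → G.dist x y = 2 →
      ∃ m, G.dist u m = 2 ∧ G.dist x m = 1 ∧ G.dist y m = 1 := by
    obtain ⟨u, p, q, hup, huq, hpq⟩ := h221
    obtain ⟨p', hp1, hp2⟩ := hc.exists_between u p (k := 1) (by omega)
    rw [hup] at hp2
    have hne : p' ≠ q := by
      rintro rfl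
      omega
    have hpp' : G.dist p p' = 1 := by rwa [G.dist_comm]
    have e1 := hc.dist_eq_two hpp' hpq hne (htri _ _ _ hpp' hpq)
    obtain ⟨z, hz1, hz2, hzp⟩ : ∃ z, G.dist p' z = 1 ∧ G.dist q z = 1 ∧ p ≠ z := by
      obtain ⟨z1, z2, hd, a1, a2, b1, b2⟩ := hgen.exists_common_neighbors hc e1
      by_cases hz : p = z1
      · refine ⟨z2, b1, b2, ?_⟩
        rintro rfl
        rw [hz, SimpleGraph.dist_self] at hd
        omega
      · exact ⟨z1, a1, a2, hz⟩
    have hqp : G.dist q p = 1 := by rwa [G.dist_comm]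
    have hpz := hc.dist_eq_two hqp hz2 hzp (htri _ _ _ hqp hz2)
    have huz : G.dist u z = 2 := by
      have hzne : u ≠ z := by
        rintro rfl
        rw [G.dist_comm] at hz2
        omega
      have hup' : G.dist p' u = 1 := by rwa [G.dist_comm]
      exact hc.dist_eq_two hup' hz1 hzne (htri _ _ _ hup' hz1)
    intro u0 x y h1 h2 h3
    obtain ⟨m, hm1, hm2, hm3⟩ := hG.exists_extend₃ (u := u) (v := p) (w := z) (u' := u0) (v' := x)
      (w' := y) (by omega) (by omega) (by omega) q
    rw [G.dist_comm (u := z)] at hm3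
    exact ⟨m, by omega, by omega, by omega⟩
  obtain ⟨u, v, y, huv, huy, hvy⟩ := h424
  obtain ⟨x, hx1, hx2⟩ := hc.exists_between u v (k := 2) (by omega)
  have hstep : ∀ a b, G.dist v a = 2 → G.dist u b = 2 → G.dist a b = 1 → G.dist v b = 2 := by
    intro a b h1 h2 h3
    have t := hc.dist_triangle (u := v) (v := a) (w := b)
    have t' := hc.dist_triangle (u := u) (v := b) (w := v)
    rw [G.dist_comm (u := b)] at t'
    have := h423 u v b huv h2
    omega
  have key : ∀ y, Relation.ReflTransGen (SphereStep G u 1) x y → G.dist v y = 2 := by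
    intro y hy
    induction hy with
    | refl => rw [G.dist_comm]; omega
    | @tail b d _ hs ih =>
      obtain ⟨hb, hd, w, -, h1, h2⟩ := hs
      by_cases hbd : b = d
      · rwa [← hbd]
      · have e := hc.dist_eq_two h1 h2 hbd (htri _ _ _ h1 h2)
        obtain ⟨m, hm, hbm, hdm⟩ := hmid u b d hb hd e
        rw [G.dist_comm (u := d)] at hdm
        exact hstep m d (hstep b m ih hm hbm) hd hdm
  have := key y (hgen.sphere_connected hG u 1 x y hx1 huy)
  omega

end IsGenericType

/-! ### From the twisted structure to a geodesic twist -/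

theorem SimpleGraph.Connected.mem_distanceLanguage_of_le {V : Type*} {G : SimpleGraph V}
    (hc : G.Connected) {i j : ℕ} (hi : i ∈ distanceLanguage G) (hj : 1 ≤ j) (hji : j ≤ i) :
    j ∈ distanceLanguage G := by
  obtain ⟨-, u, v, huv⟩ := hi
  obtain ⟨w, hw, -⟩ := hc.exists_between u v (k := j) (by omega)
  exact ⟨hj, u, w, hw⟩

theorem SimpleGraph.Connected.distanceLanguage_eq_Icc {V : Type*} {G : SimpleGraph V}
    (hc : G.Connected) (hd : G.ediam ≠ ⊤) : distanceLanguage G = Set.Icc 1 G.diam := by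
  ext i
  constructor
  · rintro ⟨hi, u, v, rfl⟩
    exact ⟨hi, SimpleGraph.dist_le_diam hd⟩
  · rintro ⟨h1, h2⟩
    have := hc.nonempty
    obtain ⟨u, v, huv⟩ := G.exists_dist_eq_diam
    exact hc.mem_distanceLanguage_of_le ⟨by omega, u, v, huv⟩ h1 h2

theorem SimpleGraph.Connected.mem_distanceLanguage_of_ediam {V : Type*} {G : SimpleGraph V}
    (hc : G.Connected) (hd : G.ediam = ⊤) {i : ℕ} (hi : 1 ≤ i) : i ∈ distanceLanguage G := by
  obtain ⟨u, v, huv⟩ := SimpleGraph.ediam_eq_top.1 hd i (ENat.natCast_lt_top i)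
  rw [← (hc u v).coe_dist_eq_edist, Nat.cast_lt] at huv
  exact hc.mem_distanceLanguage_of_le ⟨by omega, u, v, rfl⟩ hi huv.le

/-- If one graph metric is a function of another, then this function satisfies the triangle
inequality on geodesics. -/
theorem SimpleGraph.Connected.map_dist_add {V : Type*} {G H : SimpleGraph V} (hG : G.Connected)
    (hH : H.Connected) {s : ℕ → ℕ} (hs : ∀ u v, H.dist u v = s (G.dist u v)) (i j : ℕ)
    (hij : i + j ∈ distanceLanguage G) : s (i + j) ≤ s i + s j ∧ s i ≤ s (i + j) + s j := by
  obtain ⟨-, u, v, huv⟩ := hij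
  obtain ⟨w, hw1, hw2⟩ := hG.exists_between u v (k := i) (by omega)
  have hj : G.dist w v = j := by omega
  have t1 := hH.dist_triangle (u := u) (v := w) (w := v)
  have t2 := hH.dist_triangle (u := u) (v := v) (w := w)
  rw [H.dist_comm (u := v)] at t2
  rw [hs, hs, hs, huv, hw1, hj] at t1 t2
  exact ⟨t1, t2⟩

open Classical in
/-- The extension by `0` of a permutation of a set of natural numbers. -/
noncomputable def Equiv.extendZero {L : Set ℕ} (σ : L ≃ L) (n : ℕ) : ℕ :=
  if h : n ∈ L then σ ⟨n, h⟩ else 0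

theorem Equiv.extendZero_of_mem {L : Set ℕ} (σ : L ≃ L) {n : ℕ} (h : n ∈ L) :
    σ.extendZero n = σ ⟨n, h⟩ :=
  dif_pos h

theorem Equiv.extendZero_coe {L : Set ℕ} (σ : L ≃ L) (i : L) :
    σ.extendZero i = σ i :=
  σ.extendZero_of_mem i.2

theorem dist_eq_extendZero {V : Type*} {G H : SimpleGraph V} (hG : G.Connected)
    {L : Set ℕ} (hL : distanceLanguage G = L) (σ : Equiv.Perm L)
    (h : ∀ (i : L) u v, G.dist u v = i → H.dist u v = σ i) (u v : V) :
    H.dist u v = σ.extendZero (G.dist u v) := by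
  subst hL
  -- On the diagonal the identity holds because the extension takes the value 0 at 0.
  by_cases huv : u = v
  · subst huv
    simp [Equiv.extendZero, distanceLanguage]
  · have hm : G.dist u v ∈ distanceLanguage G := ⟨hG.pos_dist_of_ne huv, u, v, rfl⟩
    rw [σ.extendZero_of_mem hm]
    exact h ⟨_, hm⟩ u v rfl

theorem isGeodesicTwist_of_dist {V : Type*} {G H : SimpleGraph V} (hG : G.Connected)
    (hH : H.Connected) (hL : distanceLanguage H = distanceLanguage G)
    (σ : Equiv.Perm (distanceLanguage G))
    (hs : ∀ u v, H.dist u v = σ.extendZero (G.dist u v))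
    (hx : ∀ u v, G.dist u v = σ.symm.extendZero (H.dist u v)) :
    IsGeodesicTwist (distanceLanguage G) σ.extendZero σ.symm.extendZero where
  pos i hi := hi.1
  down i hi j h1 h2 := hG.mem_distanceLanguage_of_le hi h1 h2
  s_mem i hi := by
    rw [σ.extendZero_of_mem hi]
    exact (σ _).2
  x_mem i hi := by
    rw [σ.symm.extendZero_of_mem hi]
    exact (σ.symm _).2
  x_s i hi := by
    rw [σ.extendZero_of_mem hi, Equiv.extendZero_coe, Equiv.symm_apply_apply]
  s_x i hi := by
    rw [σ.symm.extendZero_of_mem hi, Equiv.extendZero_coe, Equiv.apply_symm_apply]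
  s_add i j _ _ hij := hG.map_dist_add hH hs i j hij
  x_add i j _ _ hij := hH.map_dist_add hG hx i j (by rwa [hL])

theorem theorem3p5 {V : Type*} (G : SimpleGraph V)
    (hG : IsMetricallyHomogeneous G) (hgen : IsGenericType G)
    (σ : Equiv.Perm (distanceLanguage G)) (hσ : σ ≠ 1)
    (hGσ : IsMetricallyHomogeneousStructure (twist (distanceStructure G) σ)) :
    G.ediam ≠ ⊤ ∧
      ((∀ i, (σ i : ℕ) = rho G.diam i) ∨
        (∀ i, (σ i : ℕ) = rhoInv G.diam i) ∨
        (∀ i, (σ i : ℕ) = tau G.diam 0 i) ∨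
        (∀ i, (σ i : ℕ) = tau G.diam 1 i)) := by
  obtain ⟨H, ⟨hH, -⟩, hL, hM⟩ := hGσ
  have hs : ∀ u v, H.dist u v = σ.extendZero (G.dist u v) :=
    dist_eq_extendZero hG.1 rfl σ fun i u v h => by
      rw [← hM (σ i)]
      simpa [twist, distanceStructure] using h
  have hx : ∀ u v, G.dist u v = σ.symm.extendZero (H.dist u v) :=
    dist_eq_extendZero hH hL σ.symm fun i u v h => by
      rwa [← hM i] at h
  have h := isGeodesicTwist_of_dist hG.1 hH hL σ hs hx
  have hiso : ∀ i, 1 ≤ i → i + 1 ∈ distanceLanguage G →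
      σ.extendZero 2 ≤ σ.extendZero i + σ.extendZero i := by
    rintro i hi ⟨-, u, z, huz⟩
    obtain ⟨j, rfl⟩ : ∃ j, i = j + 1 := ⟨i - 1, by omega⟩
    obtain ⟨p, q, hpq, hp, hq, -⟩ := hgen.exists_neighbors_below hG.1 huz
    have t := hH.dist_triangle (u := p) (v := u) (w := q)
    rw [H.dist_comm (u := p) (v := u)] at t
    rwa [hs, hs, hs, hpq, hp, hq] at t
  obtain ⟨i, hi⟩ : ∃ i : distanceLanguage G, (σ i : ℕ) ≠ i := by
    by_contra hcon
    push Not at hcon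
    exact hσ (Equiv.ext fun i => Subtype.ext (hcon i))
  have hd : G.ediam ≠ ⊤ := fun htop => by
    have h1 := h.map_one_eq_of_unbounded
      (fun i hi => hG.1.mem_distanceLanguage_of_ediam htop hi) hiso
    exact hi ((σ.extendZero_coe i).symm.trans (h.eq_self_of_map_one h1 i i.2))
  refine ⟨hd, ?_⟩
  have hIcc := hG.1.distanceLanguage_eq_Icc hd
  have hmem : ∀ i : distanceLanguage G, 1 ≤ (i : ℕ) ∧ (i : ℕ) ≤ G.diam :=
    fun i => hIcc.le i.2
  generalize G.diam = δ at *
  have hdist : ∀ n, 1 ≤ n → n ≤ δ → ∃ u v, H.dist u v = n := fun n h1 h2 => by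
    have : n ∈ distanceLanguage H := by rw [hL, hIcc]; exact ⟨h1, h2⟩
    exact this.2
  have hxs : ∀ n, 1 ≤ n → n ≤ δ → σ.symm.extendZero (σ.extendZero n) = n := fun n h1 h2 =>
    h.x_s n (by rw [hIcc]; exact ⟨h1, h2⟩)
  have key := IsGeodesicTwist.classification (δ := δ) (s := σ.extendZero)
    (x := σ.symm.extendZero) (by rw [← hIcc]; exact h)
    ⟨i, (hmem i).1, (hmem i).2, by rwa [σ.extendZero_coe]⟩
    (fun i hi hiδ => hiso i hi (by rw [hIcc]; exact ⟨by omega, hiδ⟩)) (by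
      intro h3 hδ
      -- The ends of a path of length 2 in `H` are distinct and both at old distance δ from its
      -- middle, so the last sphere of `G` is not a single point.
      obtain ⟨a, b, hab⟩ := hdist 2 (by omega) (by omega)
      obtain ⟨c, hc1, hc2⟩ := hH.exists_between a b (k := 1) (by omega)
      have x1 : σ.symm.extendZero 1 = δ := by rw [← hδ, hxs δ (by omega) le_rfl]
      have e1 : G.dist c a = δ := by rw [G.dist_comm, hx, hc1, x1]
      have e2 : G.dist c b = δ := by rw [hx, hc2, hab, x1]
      obtain ⟨j, rfl⟩ : ∃ j, δ = j + 1 := ⟨δ - 1, by omega⟩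
      obtain ⟨z, z', hz, hz', hzz⟩ := hgen.exists_close_of_ne hG e1 e2 (by
        rintro rfl
        simp at hab)
      have t := hH.dist_triangle (u := z) (v := c) (w := z')
      rw [H.dist_comm (u := z) (v := c), hs c, hs c, hz, hz', hδ, hs] at t
      rcases hzz with hzz | hzz <;> rw [hzz] at t
      · exact Or.inl t
      · exact Or.inr t) (by
      rintro rfl s4 s2 s1 s3 s5
      have x1 := hxs 4 (by omega) (by omega)
      have x2 := hxs 2 (by omega) (by omega)
      have x4 := hxs 1 (by omega) (by omega)
      rw [s4] at x1
      rw [s2] at x2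
      rw [s1] at x4
      -- The triangles (4, 1, 4) and (4, 2, 3) would become (1, 4, 1) and (1, 2, 5); (2, 2, 1) and
      -- (4, 2, 4) come from geodesics of `H` with sides (2, 2, 4) and (1, 2, 1).
      refine hgen.false_of_triangles hG ?_ ?_ ?_ ?_ ?_
      · have : 5 ∈ distanceLanguage G := by rw [hIcc]; exact ⟨by omega, le_rfl⟩
        exact this.2
      · intro u v w huv hvw huw
        have t := hH.dist_triangle (u := v) (v := u) (w := w)
        rw [H.dist_comm (u := v) (v := u), hs, hs, hs, huv, hvw, huw] at t
        omega
      · intro u v w huv huw hvw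
        have t := hH.dist_triangle (u := v) (v := u) (w := w)
        rw [H.dist_comm (u := v) (v := u), hs, hs, hs, huv, hvw, huw] at t
        omega
      · obtain ⟨v, w, hvw⟩ := hdist 4 (by omega) (by omega)
        obtain ⟨u, hu1, hu2⟩ := hH.exists_between v w (k := 2) (by omega)
        refine ⟨u, v, w, ?_, ?_, ?_⟩
        · rw [G.dist_comm, hx, hu1, x2]
        · rw [hx, hu2, hvw, x2]
        · rw [hx, hvw, x4]
      · obtain ⟨u, w, huw⟩ := hdist 2 (by omega) (by omega)
        obtain ⟨v, hv1, hv2⟩ := hH.exists_between u w (k := 1) (by omega)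
        refine ⟨u, v, w, ?_, ?_, ?_⟩
        · rw [hx, hv1, x1]
        · rw [hx, huw, x2]
        · rw [hx, hv2, huw, x1])
  have conv : ∀ f : ℕ → ℕ, (∀ i, 1 ≤ i → i ≤ δ → σ.extendZero i = f i) →
      ∀ i, (σ i : ℕ) = f i := fun f hf i => by
    rw [← σ.extendZero_coe, hf i (hmem i).1 (hmem i).2]
  exact key.imp (conv _) (Or.imp (conv _) (Or.imp (conv _) (conv _)))
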